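/- Let $A$ be a complex $2\times2$ matrix with a non-real eigenvalue $\lambda$ and a real eigenvalue $\lambda_0$. The conformal range (real Davis--Wielandt shell) of $A$ in the Beltrami--Cayley--Klein (BCK) model is the subset \[ \left\{\left(\frac{2\,\mathrm{Re}\langle y,x\rangle}{|y|^2+|x|^2},\ \frac{|y|^2-|x|^2}{|y|^2+|x|^2}\right)\ :\ x\in\mathbb C^2\setminus\{0\},\ y=Ax\right\} \] of the closed unit disk, regarded as the asymptotically closed hyperbolic plane: the points of the open disk are the ordinary points and those of the unit circle the asymptotic points. A complex number $w$ parametrizes the point $\left(\frac{2\,\mathrm{Re}\,w}{|w|^2+1},\frac{|w|^2-1}{|w|^2+1}\right)$; on the upper half-plane this identifies the Poincaré half-plane model with the ordinary points. Let $\Lambda$ (ordinary) and $\Lambda_0$ (asymptotic) be the points parametrized by $\lambda$ and $\lambda_0$ (so $\Lambda$ is $\mathrm{Re}\,\lambda+i\,|\mathrm{Im}\,\lambda|$ in the half-plane model). Let $\mathrm d$ be the hyperbolic distance, and let $\mathrm d_0$ be any distance function from $\Lambda_0$, i.e. the signed distance function (negative inside) from some horocycle with asymptotic point $\Lambda_0$.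 Let $R$ be the set of ordinary points of the conformal range. Then the only asymptotic point of the conformal range is $\Lambda_0$, and $R$ has a unique vertex $V$, i.e. a point of $R$ farthest from $\Lambda_0$ ($\mathrm d_0(x)<\mathrm d_0(V)$ for all $x\in R$, $x\ne V$). Put \[ \mathrm d_C(x)=\mathrm d_0(x)+\mathrm d_0(\Lambda)-2\,\mathrm d_0(V),\qquad C=\{x:\mathrm d_C(x)=0\}. \] The set $C$ is a horocycle with asymptotic point $\Lambda_0$, it passes through the reflection of $\Lambda$ in the point $V$, and $\mathrm d_C$ is the signed distance from $C$ (negative inside $C$). Moreover: 1. $R=\{x:\mathrm d(x,\Lambda)+\mathrm d_C(x)\le0\}$, and the boundary of $R$ in the hyperbolic plane is $\{x:\mathrm d(x,\Lambda)+\mathrm d_C(x)=0\}$. 2. If $A$ is not normal, then also $R=\{x:\mathrm d(x,\Lambda)\le|\mathrm d_C(x)|\}$, and the boundary of $R$ is $\{x:\mathrm d(x,\Lambda)=|\mathrm d_C(x)|\}$, the set of points of equal distance from $\Lambda$ and from the horocycle $C$. It is the synthetic $h$-elliptic parabola with focus $\Lambda$ and vertex $V$ associated to $C$: $\Lambda$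 lies strictly inside $C$, the boundary is $\{x:\mathrm d(\Lambda,x)+\mathrm d_C(x)=0\}$, and $V$ is the midpoint of $\Lambda$ and the pedal point of $\Lambda$ on $C$. -/

import Mathlib

open scoped UpperHalfPlane

noncomputable section

namespace ConformalRange

/-- The point of the asymptotically closed Beltrami--Cayley--Klein disk `x ^ 2 + z ^ 2 ≤ 1`
parametrized by a complex number `w`. Complex conjugate numbers give the same point, real
numbers give asymptotic points (on the unit circle), and the points of the upper half-plane
correspond bijectively to the ordinary hyperbolic points (the open unit disk). -/
def iotaBCK (w : ℂ) : ℝ × ℝ :=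
  (2 * w.re / (Complex.normSq w + 1), (Complex.normSq w - 1) / (Complex.normSq w + 1))

/-- The conformal range (real Davis--Wielandt shell) of a complex `2 × 2` matrix, in the
Beltrami--Cayley--Klein model. -/
def conformalRange (A : Matrix (Fin 2) (Fin 2) ℂ) : Set (ℝ × ℝ) :=
  {p | ∃ x y : EuclideanSpace ℂ (Fin 2), x ≠ 0 ∧ Matrix.toEuclideanLin A x = y ∧
    p = (2 * (inner ℂ x y).re / (‖y‖ ^ 2 + ‖x‖ ^ 2),
      (‖y‖ ^ 2 - ‖x‖ ^ 2) / (‖y‖ ^ 2 + ‖x‖ ^ 2))}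

/-- The ordinary (non-asymptotic) hyperbolic points of the conformal range. The hyperbolic plane
is the upper half-plane `ℍ` with its hyperbolic metric, transcribed to the
Beltrami--Cayley--Klein model by `iotaBCK`. -/
def ordinaryRange (A : Matrix (Fin 2) (Fin 2) ℂ) : Set ℍ :=
  {x | iotaBCK (x : ℂ) ∈ conformalRange A}

/-- The asymptotic points of the conformal range, in the Beltrami--Cayley--Klein model. -/
def asymptoticRange (A : Matrix (Fin 2) (Fin 2) ℂ) : Set (ℝ × ℝ) :=
  {p | p ∈ conformalRange A ∧ p.1 ^ 2 + p.2 ^ 2 = 1}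

/-- The ordinary hyperbolic point parametrized by a non-real complex number. -/
def hPoint (w : ℂ) (hw : w.im ≠ 0) : ℍ :=
  ⟨⟨w.re, |w.im|⟩, abs_pos.mpr hw⟩

theorem iotaBCK_hPoint (w : ℂ) (hw : w.im ≠ 0) :
    iotaBCK (hPoint w hw : ℂ) = iotaBCK w := by
  simp [iotaBCK, hPoint, Complex.normSq_apply]

/-- The horocycle of parameter `c > 0` with asymptotic point `ξ ∈ ℝ`: in the upper half-plane it
is the Euclidean circle of diameter `c` tangent to the real line at `ξ`. -/
def horocycle (ξ c : ℝ) : Set ℍ :=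
  {x | Complex.normSq ((x : ℂ) - (ξ : ℂ)) = c * x.im}

/-- The open horodisk bounded by `horocycle ξ c`. -/
def horodisk (ξ c : ℝ) : Set ℍ :=
  {x | Complex.normSq ((x : ℂ) - (ξ : ℂ)) < c * x.im}

open Classical in
/-- The signed hyperbolic distance from `horocycle ξ c`, negative inside the horocycle. -/
def signedDist (ξ c : ℝ) (x : ℍ) : ℝ :=
  if x ∈ horodisk ξ c then -Metric.infDist x (horocycle ξ c)
  else Metric.infDist x (horocycle ξ c)

/-- `d` is a (regularized) distance function from the asymptotic point `ξ ∈ ℝ`, that is, the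
signed distance function from one of the horocycles at `ξ`. -/
def IsDistanceFunctionFrom (ξ : ℝ) (d : ℍ → ℝ) : Prop :=
  ∃ c : ℝ, 0 < c ∧ d = signedDist ξ c

/-- `V` is the vertex of `R`, with respect to a distance function `d` from an asymptotic point:
the point of `R` farthest from the asymptotic point (all other points are strictly nearer). -/
def IsVertex (d : ℍ → ℝ) (R : Set ℍ) (V : ℍ) : Prop :=
  V ∈ R ∧ ∀ x ∈ R, x ≠ V → d x < d V

/-- `V` is the hyperbolic midpoint of `F` and `P`; equivalently, `P` is the reflection of `F`
in the point `V`. -/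
def IsHMidpoint (V F P : ℍ) : Prop :=
  dist F V = dist V P ∧ dist F P = dist F V + dist V P

/-- `P` is the pedal point of `F` on `C`: the point of `C` nearest to `F`. -/
def IsPedalPoint (F : ℍ) (C : Set ℍ) (P : ℍ) : Prop :=
  P ∈ C ∧ dist F P = Metric.infDist F C

/-- `E` is the set of ordinary points of the synthetic `h`-elliptic parabola with focus `F` and
vertex `V` associated to the horocycle `horocycle ξ c`: the focus lies strictly inside the
horocycle, the points `x` of `E` are those with `d(F, x) + d_C(x) = 0`, and the vertex lies
halfway between the focus and its pedal point on the horocycle. -/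
def IsSyntheticEllipticParabola (ξ c : ℝ) (F V : ℍ) (E : Set ℍ) : Prop :=
  0 < c ∧ signedDist ξ c F < 0 ∧ E = {x | dist F x + signedDist ξ c x = 0} ∧
    ∃ P : ℍ, IsPedalPoint F (horocycle ξ c) P ∧ IsHMidpoint V F P

end ConformalRange

end

noncomputable section

namespace ConformalRange

open Real

/-! The isometry `toInfinity` moves `lam0` to infinity. Horocycles at `lam0` become horizontal
lines, and the signed distance from the one with parameter `c` becomes `-log (c * height)`
(`signedDist_eq_neg_log`); in particular "farthest from `lam0`" means "lowest".

In an orthonormal basis with `A e₀ = lam0 e₀` and `A e₁ = t e₀ + lam e₁`, let `P` be the weight of a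
unit vector `x` on `e₁`. Then `|(A - lam0) x|²` is proportional to `P`, while the cross term in
`Re⟨Ax, x⟩` takes every value of modulus at most `|t| √(P (1 - P))`, by choice of phases. Hence the
range is given by a quadratic inequality (`mem_conformalRange_iff`). With `lam0` at infinity and `L
= (L.re, l)` the image of the focus, it reads `h² (X.re - L.re)² ≤ (l² - h²) (X.im² - h²)` together
with `h ≤ X.im`, for some `h ≤ l` (`exists_mem_ordinaryRange_iff`).

Comparing hyperbolic cosines, this is exactly `dist X L ≤ log (l / h² * X.im)` (`dist_le_log_iff`),
that is, `d(x, Λ) + d_C(x) ≤ 0` for the horocycle of height `h² / l`. The vertex is the point of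
height `h` below `L`, and reflection in it takes height `l` to `h² / l`. For non-normal `A` one has
`t ≠ 0`, so `h < l` and the focus is strictly inside `C`; for normal `A` the set degenerates to a
geodesic ray issuing from `Λ`. -/

/-! ### Horocycles and signed distance with the asymptotic point at infinity -/

/-- The matrix acting on the upper half-plane as `z ↦ -1 / z`. -/
def inversion : Matrix.SpecialLinearGroup (Fin 2) ℝ := ⟨!![0, -1; 1, 0], by simp⟩

/-- The isometry `z ↦ -1 / (z - ξ)` of the upper half-plane, which moves `ξ` to infinity. -/
def toInfinity (ξ : ℝ) : ℍ ≃ᵢ ℍ :=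
  (IsometryEquiv.mk (AddAction.toPerm (-ξ)) (UpperHalfPlane.isometry_real_vadd (-ξ))).trans
    (IsometryEquiv.constSMul inversion)

theorem coe_toInfinity (ξ : ℝ) (x : ℍ) :
    (toInfinity ξ x : ℂ) = (-((x : ℂ) - ξ))⁻¹ := by
  change ((inversion • ((-ξ) +ᵥ x) : ℍ) : ℂ) = _
  rw [UpperHalfPlane.coe_specialLinearGroup_apply]
  simp [inversion, neg_div, ← inv_neg, sub_eq_neg_add]

theorem normSq_sub_pos (ξ : ℝ) (x : ℍ) : 0 < Complex.normSq ((x : ℂ) - ξ) := by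
  rw [Complex.normSq_pos]
  intro h
  have := congrArg Complex.im h
  simp at this
  exact x.im_pos.ne' this

theorem toInfinity_im (ξ : ℝ) (x : ℍ) :
    (toInfinity ξ x).im = x.im / Complex.normSq ((x : ℂ) - ξ) := by
  rw [← UpperHalfPlane.coe_im, coe_toInfinity, Complex.inv_im, Complex.normSq_neg]
  simp

theorem toInfinity_re (ξ : ℝ) (x : ℍ) :
    (toInfinity ξ x).re = -(x.re - ξ) / Complex.normSq ((x : ℂ) - ξ) := by
  rw [← UpperHalfPlane.coe_re, coe_toInfinity, Complex.inv_re, Complex.normSq_neg]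
  simp

/-- The vertical projection is the nearest point, because `log ∘ im` is 1-Lipschitz and vertical
lines attain equality. -/
theorem infDist_setOf_im_eq {h : ℝ} (hh : 0 < h) (X : ℍ) :
    Metric.infDist X {Y : ℍ | Y.im = h} = |log (X.im / h)| := by
  have hlog : log (X.im / h) = log X.im - log h := log_div X.im_pos.ne' hh.ne'
  apply le_antisymm
  · have hY : (⟨⟨X.re, h⟩, hh⟩ : ℍ) ∈ {Y : ℍ | Y.im = h} := rfl
    refine (Metric.infDist_le_dist_of_mem hY).trans (le_of_eq ?_)
    rw [UpperHalfPlane.dist_of_re_eq (by rfl), Real.dist_eq, hlog]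
    rfl
  · refine (Metric.le_infDist (s := {Y : ℍ | Y.im = h}) ⟨(⟨⟨0, h⟩, hh⟩ : ℍ), Set.mem_ofPred.2 rfl⟩).2 fun Y hY => ?_
    have := UpperHalfPlane.dist_log_im_le X Y
    rwa [Real.dist_eq, show Y.im = h from hY, ← hlog] at this

theorem mem_horocycle_iff {ξ c : ℝ} (hc : 0 < c) (x : ℍ) :
    x ∈ horocycle ξ c ↔ (toInfinity ξ x).im = c⁻¹ := by
  have := normSq_sub_pos ξ x
  rw [toInfinity_im, div_eq_iff this.ne', eq_inv_mul_iff_mul_eq₀ hc.ne', eq_comm]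
  rfl

theorem mem_horodisk_iff (ξ c : ℝ) (x : ℍ) :
    x ∈ horodisk ξ c ↔ 1 < c * (toInfinity ξ x).im := by
  have := normSq_sub_pos ξ x
  rw [toInfinity_im, ← mul_div_assoc, one_lt_div this]
  rfl

theorem infDist_horocycle {ξ c : ℝ} (hc : 0 < c) (x : ℍ) :
    Metric.infDist x (horocycle ξ c) = |log (c * (toInfinity ξ x).im)| := by
  have himage : toInfinity ξ '' horocycle ξ c = {Y : ℍ | Y.im = c⁻¹} := by
    ext Y
    constructor
    · rintro ⟨x, hx, rfl⟩
      exact (mem_horocycle_iff hc x).1 hx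
    · intro hY
      refine ⟨(toInfinity ξ).symm Y, (mem_horocycle_iff hc _).2 ?_, by simp⟩
      simpa using hY
  rw [← Metric.infDist_image (toInfinity ξ).isometry, himage,
    infDist_setOf_im_eq (inv_pos.2 hc), div_inv_eq_mul, mul_comm]

theorem signedDist_eq_neg_log {ξ c : ℝ} (hc : 0 < c) (x : ℍ) :
    signedDist ξ c x = -log (c * (toInfinity ξ x).im) := by
  have hpos : 0 < c * (toInfinity ξ x).im := mul_pos hc (toInfinity ξ x).im_pos
  unfold signedDist
  rw [infDist_horocycle hc]
  split_ifs with h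
  · rw [mem_horodisk_iff] at h
    rw [abs_of_pos (log_pos h)]
  · rw [mem_horodisk_iff, not_lt] at h
    rw [abs_of_nonpos (log_nonpos hpos.le h)]

theorem continuous_signedDist {ξ c : ℝ} (hc : 0 < c) : Continuous (signedDist ξ c) := by
  have : signedDist ξ c = fun x => -log (c * (toInfinity ξ x).im) :=
    funext fun x => signedDist_eq_neg_log hc x
  rw [this]
  refine (Continuous.log ?_ fun x => (mul_pos hc (toInfinity ξ x).im_pos).ne').neg
  exact continuous_const.mul (UpperHalfPlane.continuous_im.comp (toInfinity ξ).continuous)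

/-! ### The region `d(x, Λ) + d_C(x) ≤ 0` and its frontier -/

theorem cosh_dist_eq (X Y : ℍ) :
    cosh (dist X Y) = 1 + ((X.re - Y.re) ^ 2 + (X.im - Y.im) ^ 2) / (2 * X.im * Y.im) := by
  rw [UpperHalfPlane.cosh_dist, Complex.dist_eq, ← Complex.normSq_eq_norm_sq,
    Complex.normSq_apply]
  simp [pow_two]

/-- The difference of the hyperbolic cosines of the two sides is a positive multiple of the
quadratic expression, but passing to `cosh` requires the logarithm to be nonnegative. The clause `h
≤ X.im` supplies this. It matters only when `h = L.im`: there the quadratic condition gives a full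
vertical line, of which only the upper ray is wanted. -/
theorem dist_le_log_iff {L X : ℍ} {h : ℝ} (hh : 0 < h) (hL : h ≤ L.im) :
    dist X L ≤ log (L.im / h ^ 2 * X.im) ↔
      h ^ 2 * (X.re - L.re) ^ 2 ≤ (L.im ^ 2 - h ^ 2) * (X.im ^ 2 - h ^ 2) ∧ h ≤ X.im := by
  have hl := L.im_pos
  have hx := X.im_pos
  set l := L.im with hl'
  set y := X.im with hy'
  have hpos : 0 < l / h ^ 2 * y := by positivity
  have hcosh : 0 ≤ log (l / h ^ 2 * y) → (dist X L ≤ log (l / h ^ 2 * y) ↔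
      h ^ 2 * (X.re - L.re) ^ 2 ≤ (l ^ 2 - h ^ 2) * (y ^ 2 - h ^ 2)) := by
    intro h0
    rw [← abs_of_nonneg h0, ← abs_of_nonneg (dist_nonneg (x := X) (y := L)), ← cosh_le_cosh,
      cosh_dist_eq, cosh_log hpos, ← sub_nonneg,
      ← sub_nonneg (b := h ^ 2 * _)]
    have : (l / h ^ 2 * y + (l / h ^ 2 * y)⁻¹) / 2 -
        (1 + ((X.re - L.re) ^ 2 + (y - l) ^ 2) / (2 * y * l)) =
        ((l ^ 2 - h ^ 2) * (y ^ 2 - h ^ 2) - h ^ 2 * (X.re - L.re) ^ 2) /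
          (2 * y * l * h ^ 2) := by
      field_simp
      ring
    rw [← hl', ← hy', this]
    rw [le_div_iff₀ (by positivity), zero_mul]
  constructor
  · intro hd
    have h0 := dist_nonneg.trans hd
    have hq := (hcosh h0).1 hd
    refine ⟨hq, ?_⟩
    have h1 : 1 ≤ l / h ^ 2 * y := (log_nonneg_iff hpos).1 h0
    have h2 : h ^ 2 ≤ l * y := by
      rw [div_mul_eq_mul_div, le_div_iff₀ (by positivity)] at h1
      linarith
    by_contra hlt
    push Not at hlt
    rcases hL.eq_or_lt with he | he
    · rw [← he] at h2
      nlinarith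
    · have h3 : 0 < (l ^ 2 - h ^ 2) * (h ^ 2 - y ^ 2) :=
        mul_pos (by nlinarith) (by nlinarith)
      nlinarith [sq_nonneg (h * (X.re - L.re))]
  · rintro ⟨hq, hy⟩
    refine (hcosh (log_nonneg ?_)).2 hq
    rw [div_mul_eq_mul_div, le_div_iff₀ (by positivity)]
    nlinarith

/-- Moving horizontally away from the vertical line through `L` increases the distance. -/
theorem exists_lt_dist_vadd (X L : ℍ) : ∃ s : ℝ, ∀ ε : ℝ, 0 < ε → 
    dist X L < dist ((ε * s) +ᵥ X) L := by
  have key : ∀ s : ℝ, s ^ 2 = 1 → 0 ≤ s * (X.re - L.re) →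
      ∀ ε : ℝ, 0 < ε → dist X L < dist ((ε * s) +ᵥ X) L := by
    intro s hs h0 ε hε
    rw [← abs_of_nonneg (dist_nonneg (x := X) (y := L)),
      ← abs_of_nonneg (dist_nonneg (x := (ε * s) +ᵥ X) (y := L)), ← cosh_lt_cosh,
      cosh_dist_eq, cosh_dist_eq, UpperHalfPlane.vadd_re, UpperHalfPlane.vadd_im]
    have := X.im_pos
    have := L.im_pos
    gcongr 1 + (?_ + _) / _
    have : (ε * s + X.re - L.re) ^ 2 =
        (X.re - L.re) ^ 2 + ε ^ 2 * s ^ 2 + 2 * ε * (s * (X.re - L.re)) := by ring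
    rw [this, hs]
    have : 0 ≤ 2 * ε * (s * (X.re - L.re)) := by positivity
    nlinarith [pow_pos hε 2]
  rcases le_total 0 (X.re - L.re) with h | h
  · exact ⟨1, key 1 (by norm_num) (by linarith)⟩
  · exact ⟨-1, key (-1) (by norm_num) (by linarith)⟩

/-- Continuity gives only one inclusion. For the other, a point of the level set is pushed along its
own horocycle at `ξ`, away from the geodesic from `L` to `ξ`: the signed distance stays constant
while the distance to `L` grows, so the point is not interior. -/
theorem frontier_dist_add_signedDist {ξ c : ℝ} (hc : 0 < c) (L : ℍ) :
    frontier {x : ℍ | dist x L + signedDist ξ c x ≤ 0} =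
      {x : ℍ | dist x L + signedDist ξ c x = 0} := by
  have hcont : Continuous fun x : ℍ => dist x L + signedDist ξ c x :=
    (continuous_id.dist continuous_const).add (continuous_signedDist hc)
  apply Set.Subset.antisymm (frontier_le_subset_eq hcont continuous_const)
  intro x hx
  have hx' : dist x L + signedDist ξ c x = 0 := hx
  refine ⟨subset_closure hx'.le, fun hint => ?_⟩
  obtain ⟨s, hs⟩ := exists_lt_dist_vadd (toInfinity ξ x) (toInfinity ξ L)
  let γ : ℝ → ℍ := fun ε => (toInfinity ξ).symm ((ε * s) +ᵥ toInfinity ξ x)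
  have hγ : Continuous γ := by
    refine (toInfinity ξ).symm.continuous.comp ?_
    rw [UpperHalfPlane.isEmbedding_coe.continuous_iff]
    have : (UpperHalfPlane.coe ∘ fun ε : ℝ => (ε * s) +ᵥ toInfinity ξ x) =
        fun ε : ℝ => ((ε * s : ℝ) : ℂ) + toInfinity ξ x := by
      ext ε
      simp
    rw [this]
    fun_prop
  have hγ0 : γ 0 = x := by simp [γ]
  -- The filter is one-sided because the distance is known to increase only for `ε > 0`.
  have hnear : ∀ᶠ ε in nhdsWithin (0 : ℝ) (Set.Ioi 0),
      γ ε ∈ interior {x : ℍ | dist x L + signedDist ξ c x ≤ 0} := by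
    apply nhdsWithin_le_nhds
    exact hγ.continuousAt.eventually (isOpen_interior.mem_nhds (by rwa [hγ0]))
  obtain ⟨ε, hε, hpos⟩ := (hnear.and self_mem_nhdsWithin).exists
  have h1 : dist (γ ε) L + signedDist ξ c (γ ε) ≤ 0 := (interior_subset hε :)
  have h2 := hs ε hpos
  have h3 : signedDist ξ c (γ ε) = signedDist ξ c x := by
    rw [signedDist_eq_neg_log hc, signedDist_eq_neg_log hc]
    simp [γ]
  have h4 : dist (γ ε) L = dist ((ε * s) +ᵥ toInfinity ξ x) (toInfinity ξ L) := by
    rw [← (toInfinity ξ).dist_eq (γ ε) L]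
    simp [γ]
  rw [(toInfinity ξ).dist_eq x L] at h2
  linarith

/-! ### Triangular form and normality -/

/-- Schur triangularization: an orthonormal basis in which `A` is upper triangular. -/
theorem exists_triangularizing_basis {A : Matrix (Fin 2) (Fin 2) ℂ} {lam mu : ℂ} (hne : lam ≠ mu)
    (hlam : Module.End.HasEigenvalue (Matrix.toLin' A) lam)
    (hmu : Module.End.HasEigenvalue (Matrix.toLin' A) mu) :
    ∃ (b : OrthonormalBasis (Fin 2) ℂ (EuclideanSpace ℂ (Fin 2))) (t : ℂ),
      Matrix.toEuclideanLin A (b 0) = mu • b 0 ∧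
      Matrix.toEuclideanLin A (b 1) = t • b 0 + lam • b 1 := by
  have lift : ∀ {ν : ℂ}, Module.End.HasEigenvalue (Matrix.toLin' A) ν →
      ∃ z : EuclideanSpace ℂ (Fin 2), z ≠ 0 ∧ Matrix.toEuclideanLin A z = ν • z := by
    intro ν hν
    obtain ⟨v, hv⟩ := hν.exists_hasEigenvector
    refine ⟨WithLp.toLp 2 v, fun h => hv.2 (by simpa using h), ?_⟩
    have := hv.apply_eq_smul
    rw [Matrix.toLin'_apply] at this
    rw [Matrix.toLpLin_toLp, ← WithLp.toLp_smul, Matrix.toLin'_apply, this]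
  obtain ⟨w, hw0, hw⟩ := lift hmu
  obtain ⟨z, hz0, hz⟩ := lift hlam
  let e : EuclideanSpace ℂ (Fin 2) := ((‖w‖ : ℂ)⁻¹) • w
  have he : ‖e‖ = 1 := by simp [e, norm_smul, hw0]
  have hAe : Matrix.toEuclideanLin A e = mu • e := by
    simp only [e, map_smul, hw]
    rw [smul_comm]
  obtain ⟨b, hb⟩ := Orthonormal.exists_orthonormalBasis_extension_of_card_eq (𝕜 := ℂ)
    (E := EuclideanSpace ℂ (Fin 2)) (ι := Fin 2) (by simp) (v := fun _ => e) (s := {0})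
    (by
      constructor
      · intro i; simpa using he
      · intro i j hij
        exact absurd (Subsingleton.elim i j) hij)
  have hb0 : b 0 = e := hb 0 rfl
  have expand : ∀ v, v = inner ℂ (b 0) v • b 0 + inner ℂ (b 1) v • b 1 := by
    intro v
    conv_lhs => rw [← b.sum_repr' v]
    rw [Fin.sum_univ_two]
  have h0 : Matrix.toEuclideanLin A (b 0) = mu • b 0 := by rw [hb0, hAe]
  set t := inner ℂ (b 0) (Matrix.toEuclideanLin A (b 1)) with ht
  set s := inner ℂ (b 1) (Matrix.toEuclideanLin A (b 1)) with hs
  have h1 : Matrix.toEuclideanLin A (b 1) = t • b 0 + s • b 1 := expand _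
  refine ⟨b, t, h0, ?_⟩
  set q := inner ℂ (b 0) z with hq
  set p := inner ℂ (b 1) z with hp
  have hz' : z = q • b 0 + p • b 1 := expand z
  -- The `b 1`-components of both sides of `A z = lam z` are compared. Since `p = 0` would make `z`
  -- an eigenvector for `mu`, this forces `s = lam`.
  have key : (p * s - lam * p) = 0 := by
    have h2 := congrArg (inner ℂ (b 1)) hz
    have h3 : Matrix.toEuclideanLin A z = q • (mu • b 0) + p • (t • b 0 + s • b 1) := by
      conv_lhs => rw [hz']
      rw [map_add, map_smul, map_smul, h0, h1]
    rw [h3] at h2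
    simp only [inner_add_right, inner_smul_right, b.inner_eq_ite, ← hp] at h2
    simp at h2
    rw [h2, sub_self]
  have hp0 : p ≠ 0 := by
    intro hp0
    have hz2 : z = q • b 0 := by rw [hz', hp0]; simp
    have hq0 : q ≠ 0 := by
      rintro h; apply hz0; rw [hz2, h, zero_smul]
    have h4 : (mu - lam) • z = 0 := by
      rw [sub_smul, ← hz]
      conv_lhs => rw [hz2, map_smul, h0, smul_comm]
      simp
    rcases smul_eq_zero.1 h4 with h | h
    · exact hne (sub_eq_zero.1 h).symm
    · exact hz0 h
  have hsl : s = lam := by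
    have : p * (s - lam) = 0 := by rw [← key]; ring
    rcases mul_eq_zero.1 this with h | h
    · exact absurd h hp0
    · exact sub_eq_zero.1 h
  rw [h1, hsl]

/-- The adjoint is diagonal in the same orthonormal basis, so it commutes with `A`. The
contrapositive yields `t ≠ 0` for non-normal `A`. -/
theorem isStarNormal_of_diagonal {A : Matrix (Fin 2) (Fin 2) ℂ} {lam mu : ℂ}
    (b : OrthonormalBasis (Fin 2) ℂ (EuclideanSpace ℂ (Fin 2)))
    (h0 : Matrix.toEuclideanLin A (b 0) = mu • b 0)
    (h1 : Matrix.toEuclideanLin A (b 1) = lam • b 1) : IsStarNormal A := by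
  have hadj : ∀ B : Matrix (Fin 2) (Fin 2) ℂ, Matrix.toEuclideanLin (star B) =
      LinearMap.adjoint (Matrix.toEuclideanLin B) := fun B =>
    Matrix.toEuclideanLin_conjTranspose_eq_adjoint B
  have a0 : Matrix.toEuclideanLin (star A) (b 0) = star mu • b 0 := by
    rw [hadj]
    refine b.repr.injective (PiLp.ext fun i => ?_)
    rw [b.repr_apply_apply, b.repr_apply_apply, LinearMap.adjoint_inner_right]
    fin_cases i <;>
    simp [h0, h1, inner_smul_left, inner_smul_right, b.inner_eq_ite]
  have a1 : Matrix.toEuclideanLin (star A) (b 1) = star lam • b 1 := by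
    rw [hadj]
    refine b.repr.injective (PiLp.ext fun i => ?_)
    rw [b.repr_apply_apply, b.repr_apply_apply, LinearMap.adjoint_inner_right]
    fin_cases i <;>
    simp [h0, h1, inner_smul_left, inner_smul_right, b.inner_eq_ite]
  constructor
  change star A * A = A * star A
  apply (Matrix.toEuclideanLin (𝕜 := ℂ) (m := Fin 2) (n := Fin 2)).injective
  refine b.toBasis.ext fun i => ?_
  rw [b.coe_toBasis, Matrix.toLpLin_mul_same, Matrix.toLpLin_mul_same]
  simp only [LinearMap.comp_apply]
  fin_cases i
  · simp [a0, h0, smul_smul, mul_comm]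
  · simp [a1, h1, smul_smul, mul_comm]

/-- Rotates `t` onto the point of its circle with real part `s`; this is the freedom of phase that
fills the conformal range. -/
theorem exists_norm_eq_one_re_mul_eq {t : ℂ} {s : ℝ} (h : s ^ 2 ≤ Complex.normSq t) :
    ∃ ω : ℂ, Complex.normSq ω = 1 ∧ (ω * t).re = s := by
  rcases eq_or_ne t 0 with rfl | ht
  · refine ⟨1, by simp, ?_⟩
    have : s ^ 2 ≤ 0 := by simpa using h
    have : s = 0 := by nlinarith
    simp [this]
  · refine ⟨⟨s, √(Complex.normSq t - s ^ 2)⟩ / t, ?_, ?_⟩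
    · rw [Complex.normSq_div, Complex.normSq_mk, Real.mul_self_sqrt (by linarith)]
      have := Complex.normSq_pos.2 ht
      field_simp
      ring
    · rw [div_mul_cancel₀ _ ht]

/-! ### The conformal range as a quadratic region -/

/-- The point of the Beltrami--Cayley--Klein plane attached to `Re⟨y, x⟩ = a` and `|y|² = b` for a
unit vector `x`. -/
def klein (a b : ℝ) : ℝ × ℝ := (2 * a / (b + 1), (b - 1) / (b + 1))

theorem klein_inj {a b a' b' : ℝ} (hb : 0 ≤ b) (hb' : 0 ≤ b') (h : klein a b = klein a' b') :
    a = a' ∧ b = b' := by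
  have h1 := congrArg Prod.fst h
  have h2 := congrArg Prod.snd h
  simp only [klein] at h1 h2
  have : b = b' := by
    field_simp at h2
    linarith
  subst this
  field_simp at h1
  exact ⟨h1, rfl⟩

theorem klein_norm_eq_one_iff {a b : ℝ} (hb : 0 ≤ b) :
    (klein a b).1 ^ 2 + (klein a b).2 ^ 2 = 1 ↔ a ^ 2 = b := by
  simp only [klein]
  field_simp
  constructor <;> intro h <;> linarith

/-- The conformal range in terms of the entries of a triangular form. -/
theorem mem_conformalRange_iff {A : Matrix (Fin 2) (Fin 2) ℂ} {lam t : ℂ} {lam0 : ℝ}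
    (e : OrthonormalBasis (Fin 2) ℂ (EuclideanSpace ℂ (Fin 2)))
    (h0 : Matrix.toEuclideanLin A (e 0) = (lam0 : ℂ) • e 0)
    (h1 : Matrix.toEuclideanLin A (e 1) = t • e 0 + lam • e 1) (p : ℝ × ℝ) :
    p ∈ conformalRange A ↔ ∃ P a b : ℝ, p = klein a b ∧ 0 ≤ b ∧ 0 ≤ P ∧ P ≤ 1 ∧
      b - 2 * lam0 * a + lam0 ^ 2 =
        P * (Complex.normSq (lam - lam0) + Complex.normSq t) ∧
      (a - lam0 - P * (lam.re - lam0)) ^ 2 ≤ Complex.normSq t * (P * (1 - P)) := by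
  have coord : ∀ q r : ℂ, ‖q • e 0 + r • e 1‖ ^ 2 = Complex.normSq q + Complex.normSq r := by
    intro q r
    rw [← inner_self_eq_norm_sq (𝕜 := ℂ)]
    simp only [inner_add_right, inner_add_left, inner_smul_left, inner_smul_right, e.inner_eq_ite]
    simp [Complex.normSq_apply]
  have coord2 : ∀ q r q' r' : ℂ, inner ℂ (q • e 0 + r • e 1) (q' • e 0 + r' • e 1) =
      star q * q' + star r * r' := by
    intro q r q' r'
    simp only [inner_add_right, inner_add_left, inner_smul_left, inner_smul_right, e.inner_eq_ite]
    simp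
    ring
  have image : ∀ q r : ℂ, Matrix.toEuclideanLin A (q • e 0 + r • e 1) =
      (lam0 * q + r * t) • e 0 + (lam * r) • e 1 := by
    intro q r
    rw [map_add, map_smul, map_smul, h0, h1]
    module
  constructor
  · rintro ⟨x, y, hx, rfl, rfl⟩
    obtain ⟨q, r, rfl⟩ : ∃ q r : ℂ, x = q • e 0 + r • e 1 :=
      ⟨inner ℂ (e 0) x, inner ℂ (e 1) x, by
        conv_lhs => rw [← e.sum_repr' x]
        rw [Fin.sum_univ_two]⟩
    have hX : 0 < Complex.normSq q + Complex.normSq r := by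
      rw [← coord]
      exact pow_pos (norm_pos_iff.2 hx) 2
    rw [image, coord, coord, coord2]
    set X := Complex.normSq q + Complex.normSq r with hXdef
    set b' := Complex.normSq (lam0 * q + r * t) + Complex.normSq (lam * r) with hb'
    have hb'0 : 0 ≤ b' := add_nonneg (Complex.normSq_nonneg _) (Complex.normSq_nonneg _)
    set a' := (star q * (lam0 * q + r * t) + star r * (lam * r)).re with ha'
    have hr0 := Complex.normSq_nonneg r
    have hq0 := Complex.normSq_nonneg q
    -- Dividing by `X` normalizes `x` to a unit vector; `P` is its weight on `e 1`.
    refine ⟨Complex.normSq r / X, a' / X, b' / X, ?_, by positivity, by positivity, ?_, ?_, ?_⟩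
    · simp only [klein, Prod.mk.injEq]
      constructor <;> field_simp
    · rw [div_le_one hX]
      linarith
    -- The left side is `|(A - lam0) x|²`, and `A - lam0` kills `e 0`.
    · have : b' - 2 * lam0 * a' + lam0 ^ 2 * X = Complex.normSq r *
          (Complex.normSq (lam - lam0) + Complex.normSq t) := by
        rw [hb', ha', hXdef]
        simp [Complex.normSq_apply]
        ring
      field_simp
      linarith
    · have h2 : a' - lam0 * X - Complex.normSq r * (lam.re - lam0) = (star q * (r * t)).re := by
        rw [ha', hXdef]
        simp [Complex.normSq_apply]
        ring
      have h3 : (star q * (r * t)).re ^ 2 ≤ Complex.normSq t * (Complex.normSq r *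
          Complex.normSq q) := by
        have := Complex.re_sq_le_normSq (star q * (r * t))
        simp only [Complex.normSq_mul] at this
        rw [Complex.star_def, Complex.normSq_conj] at this
        rw [pow_two, Complex.star_def]
        linarith
      have h4 : a' / X - lam0 - Complex.normSq r / X * (lam.re - lam0) =
          (star q * (r * t)).re / X := by
        rw [← h2]
        field_simp
      have h5 : Complex.normSq t * (Complex.normSq r / X * (1 - Complex.normSq r / X)) =
          Complex.normSq t * (Complex.normSq r * Complex.normSq q) / X ^ 2 := by
        field_simp
        rw [hXdef]
        ring
      rw [h4, h5, div_pow]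
      gcongr
  · rintro ⟨P, a, b, rfl, hb, hP0, hP1, hbP, haP⟩
    -- The moduli of the coordinates are fixed by `P`; the phase `ω` between them is chosen to give
    -- the cross term its prescribed real part.
    obtain ⟨ω, hω1, hω⟩ := exists_norm_eq_one_re_mul_eq
      (t := ((√P * √(1 - P) : ℝ) : ℂ) * t) (s := a - lam0 - P * (lam.re - lam0)) (by
        rw [Complex.normSq_mul, Complex.normSq_ofReal]
        have : √P * √(1 - P) * (√P * √(1 - P)) = P * (1 - P) := by
          rw [mul_mul_mul_comm, Real.mul_self_sqrt hP0, Real.mul_self_sqrt (by linarith)]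
        rw [this]
        linarith)
    set q : ℂ := ((√(1 - P) : ℝ) : ℂ) * star ω with hq
    set r : ℂ := ((√P : ℝ) : ℂ) with hr
    have hr2 : Complex.normSq r = P := by
      rw [hr, Complex.normSq_ofReal, Real.mul_self_sqrt hP0]
    have hq2 : Complex.normSq q = 1 - P := by
      rw [hq, Complex.normSq_mul, Complex.normSq_ofReal, Real.mul_self_sqrt (by linarith),
        Complex.star_def, Complex.normSq_conj, hω1, mul_one]
    have hx2 : ‖q • e 0 + r • e 1‖ ^ 2 = 1 := by
      rw [coord, hr2, hq2]
      ring
    have hcross : (star q * (r * t)).re = a - lam0 - P * (lam.re - lam0) := by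
      rw [← hω, hq, hr]
      congr 1
      simp
      ring
    have ha : (inner ℂ (q • e 0 + r • e 1)
        (Matrix.toEuclideanLin A (q • e 0 + r • e 1))).re = a := by
      rw [image, coord2]
      have : (star q * (lam0 * q + r * t) + star r * (lam * r)).re =
          lam0 * Complex.normSq q + (star q * (r * t)).re + Complex.normSq r * lam.re := by
        simp [Complex.normSq_apply]
        ring
      rw [this, hcross, hr2, hq2]
      ring
    have hb2 : ‖Matrix.toEuclideanLin A (q • e 0 + r • e 1)‖ ^ 2 = b := by
      rw [image, coord]
      have : Complex.normSq (lam0 * q + r * t) + Complex.normSq (lam * r) =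
          lam0 ^ 2 * Complex.normSq q + 2 * lam0 * (star q * (r * t)).re +
            Complex.normSq r * Complex.normSq t + Complex.normSq r * Complex.normSq lam := by
        simp [Complex.normSq_apply]
        ring
      rw [this, hcross, hr2, hq2]
      have h6 : Complex.normSq (lam - lam0) =
          Complex.normSq lam - 2 * lam0 * lam.re + lam0 ^ 2 := by
        simp [Complex.normSq_apply]
        ring
      rw [h6] at hbP
      linear_combination -hbP
    refine ⟨q • e 0 + r • e 1, _, ?_, rfl, ?_⟩
    · intro h
      rw [h] at hx2
      simp at hx2
    · rw [ha, hb2, hx2]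
      rfl

/-! ### Transfer to the coordinates at infinity, and asymptotic points -/

/-- The quadratic condition describing the conformal range, rewritten in the coordinates in which
the asymptotic point is at infinity. -/
theorem quadratic_iff {u y r m τ D n N h : ℝ} (hy : 0 < y) (hm : 0 < m) (hτ : 0 ≤ τ)
    (hD : D = u ^ 2 + y ^ 2) (hn : n = r ^ 2 + m ^ 2) (hN : N = n + τ) (hh : 0 < h)
    (hh2 : h ^ 2 = m ^ 2 / (n * N)) :
    (D ≤ N ∧ (u - D / N * r) ^ 2 ≤ τ * (D / N * (1 - D / N))) ↔
      (h ^ 2 * (-u / D - -r / n) ^ 2 ≤ ((m / n) ^ 2 - h ^ 2) * ((y / D) ^ 2 - h ^ 2) ∧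
        h ≤ y / D) := by
  have hD0 : 0 < D := by rw [hD]; positivity
  have hn0 : 0 < n := by rw [hn]; positivity
  have hN0 : 0 < N := by rw [hN]; positivity
  have key : (u - D / N * r) ^ 2 ≤ τ * (D / N * (1 - D / N)) ↔
      h ^ 2 * (-u / D - -r / n) ^ 2 ≤ ((m / n) ^ 2 - h ^ 2) * ((y / D) ^ 2 - h ^ 2) := by
    rw [← sub_nonneg, ← sub_nonneg (b := h ^ 2 * _)]
    have : ((m / n) ^ 2 - h ^ 2) * ((y / D) ^ 2 - h ^ 2) - h ^ 2 * (-u / D - -r / n) ^ 2 =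
        m ^ 2 / (n ^ 2 * D ^ 2) *
          (τ * (D / N * (1 - D / N)) - (u - D / N * r) ^ 2) := by
      rw [hh2]
      field_simp
      have hy2 : y ^ 2 = D - u ^ 2 := by linarith
      have hm2 : m ^ 2 = n - r ^ 2 := by linarith
      have hτ' : τ = N - n := by linarith
      rw [hy2, hm2, hτ']
      ring
    rw [this]
    exact (mul_nonneg_iff_of_pos_left (by positivity)).symm
  rw [← key, and_comm]
  refine and_congr_right fun hq => ?_
  rw [← sq_le_sq₀ hh.le (by positivity), hh2]
  -- If `τ = 0`, the quadratic inequality is the equation `u = D / n * r`, and on that curve the two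
  -- remaining bounds agree. If `τ > 0`, both bounds already follow from the quadratic inequality.
  rcases hτ.eq_or_lt with h0 | h0
  · have hNn : N = n := by linarith
    rw [← h0, zero_mul, hNn] at hq
    have hu : u = D / n * r := by nlinarith
    have hy2 : y ^ 2 = D - (D / n * r) ^ 2 := by rw [← hu]; linarith
    rw [hNn, div_pow, hy2, ← sub_nonneg (b := D), ← sub_nonneg (b := m ^ 2 / _)]
    have : (D - (D / n * r) ^ 2) / D ^ 2 - m ^ 2 / (n * n) = (n - D) / (D * n) := by
      have hm2 : m ^ 2 = n - r ^ 2 := by linarith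
      rw [hm2]
      field_simp
      ring
    rw [this, le_div_iff₀ (by positivity), zero_mul]
  · refine iff_of_true ?_ ?_
    · by_contra hlt
      push Not at hlt
      have h1 : 1 < D / N := (one_lt_div hN0).2 hlt
      have h2 : 0 < τ * (D / N * (D / N - 1)) := mul_pos h0 (mul_pos (by linarith) (by linarith))
      nlinarith [sq_nonneg (u - D / N * r)]
    · rw [key, hh2] at hq
      have h1 : 0 < (m / n) ^ 2 - m ^ 2 / (n * N) := by
        have : (m / n) ^ 2 - m ^ 2 / (n * N) = m ^ 2 * τ / (n ^ 2 * N) := by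
          have hτ' : τ = N - n := by linarith
          rw [hτ']
          field_simp
        rw [this]
        positivity
      have h2 : 0 ≤ ((m / n) ^ 2 - m ^ 2 / (n * N)) * ((y / D) ^ 2 - m ^ 2 / (n * N)) :=
        le_trans (by positivity) hq
      have := nonneg_of_mul_nonneg_right h2 h1
      linarith

/-- On the unit circle `b = a²`, which is the hypothesis `u² = P N`. If `P > 0`, dividing by `P`
leaves `n - 2 u r + P (r² + τ) ≤ 0`. For `τ > 0`, multiplying by `N (r² + τ)` and completing the
square produces the positive term `N τ (n - r²)`; for `τ = 0` the result is `n = P r² < n`. The gap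
`n - r²` is `(Im lam)²`, so this is where non-reality of `lam` enters. -/
theorem quadratic_asymptotic {u r n N τ P : ℝ} (hP0 : 0 ≤ P) (hP1 : P ≤ 1) (hτ : 0 ≤ τ)
    (hn : r ^ 2 < n) (hN : N = n + τ) (hu : u ^ 2 = P * N)
    (hq : (u - P * r) ^ 2 ≤ τ * (P * (1 - P))) : P = 0 := by
  by_contra hP
  have hP' : 0 < P := lt_of_le_of_ne hP0 (Ne.symm hP)
  have hn0 : 0 < n := lt_of_le_of_lt (sq_nonneg r) hn
  have h1 : P * (n - 2 * u * r + P * (r ^ 2 + τ)) ≤ 0 := by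
    have : (u - P * r) ^ 2 - τ * (P * (1 - P)) = P * (n - 2 * u * r + P * (r ^ 2 + τ)) := by
      have : (u - P * r) ^ 2 = u ^ 2 - 2 * u * P * r + P ^ 2 * r ^ 2 := by ring
      rw [this, hu, hN]
      ring
    linarith
  have h2 : n - 2 * u * r + P * (r ^ 2 + τ) ≤ 0 := nonpos_of_mul_nonpos_right h1 hP'
  have h3 : (u * r - N) ^ 2 ≤ τ * (N * (1 - P)) := by
    have : (u * r - N) ^ 2 = N * (n - 2 * u * r + P * (r ^ 2 + τ)) + τ * (N * (1 - P)) := by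
      have : (u * r - N) ^ 2 = u ^ 2 * r ^ 2 - 2 * u * r * N + N ^ 2 := by ring
      rw [this, hu, hN]
      ring
    rw [this]
    have := mul_nonpos_of_nonneg_of_nonpos (by linarith : 0 ≤ N) h2
    linarith
  rcases hτ.eq_or_lt with h0 | h0
  · rw [← h0, zero_mul] at h3
    have h4 : u * r = N := by nlinarith
    have h5 : N ^ 2 = P * N * r ^ 2 := by rw [← h4, mul_pow, hu, h4]
    have hNn : N = n := by linarith
    rw [hNn] at h5
    have h6 : n = P * r ^ 2 := by
      apply mul_left_cancel₀ hn0.ne'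
      linarith
    nlinarith [sq_nonneg r]
  · have h4 : (r ^ 2 + τ) * (N * (n - 2 * u * r + P * (r ^ 2 + τ))) =
        (u * (r ^ 2 + τ) - r * N) ^ 2 + N * (τ * (n - r ^ 2)) := by
      have : (u * (r ^ 2 + τ) - r * N) ^ 2 =
          u ^ 2 * (r ^ 2 + τ) ^ 2 - 2 * u * r * N * (r ^ 2 + τ) + r ^ 2 * N ^ 2 := by ring
      rw [this, hu, hN]
      ring
    have hN0 : 0 < N := by linarith
    have h5 : 0 < N * (τ * (n - r ^ 2)) := mul_pos hN0 (mul_pos h0 (sub_pos.2 hn))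
    have h6 : (r ^ 2 + τ) * (N * (n - 2 * u * r + P * (r ^ 2 + τ))) ≤ 0 :=
      mul_nonpos_of_nonneg_of_nonpos (by positivity)
        (mul_nonpos_of_nonneg_of_nonpos hN0.le h2)
    linarith [sq_nonneg (u * (r ^ 2 + τ) - r * N)]

theorem klein_re_normSq (x : ℂ) : iotaBCK x = klein x.re (Complex.normSq x) := rfl

theorem asymptoticRange_eq {A : Matrix (Fin 2) (Fin 2) ℂ} {lam t : ℂ} {lam0 : ℝ}
    (him : lam.im ≠ 0)
    (e : OrthonormalBasis (Fin 2) ℂ (EuclideanSpace ℂ (Fin 2)))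
    (h0 : Matrix.toEuclideanLin A (e 0) = (lam0 : ℂ) • e 0)
    (h1 : Matrix.toEuclideanLin A (e 1) = t • e 0 + lam • e 1) :
    asymptoticRange A = {iotaBCK (lam0 : ℂ)} := by
  have hiota : iotaBCK (lam0 : ℂ) = klein lam0 (lam0 ^ 2) := by
    rw [klein_re_normSq, Complex.normSq_ofReal, Complex.ofReal_re, pow_two]
  ext p
  rw [Set.mem_singleton_iff, hiota]
  constructor
  · rintro ⟨hp, hcirc⟩
    obtain ⟨P, a, b, rfl, hb, hP0, hP1, hbP, haP⟩ := (mem_conformalRange_iff e h0 h1 p).1 hp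
    rw [klein_norm_eq_one_iff hb] at hcirc
    have hP : P = 0 := by
      refine quadratic_asymptotic (u := a - lam0) (r := lam.re - lam0)
        (n := Complex.normSq (lam - lam0)) hP0 hP1 (Complex.normSq_nonneg t) ?_ rfl ?_ haP
      · have : 0 < lam.im ^ 2 := by positivity
        rw [Complex.normSq_apply]
        simp
        nlinarith
      · rw [← hbP, ← hcirc]
        ring
    rw [hP] at haP hbP
    have : a = lam0 := by nlinarith
    rw [← hcirc, this]
  · rintro rfl
    refine ⟨(mem_conformalRange_iff e h0 h1 _).2
      ⟨0, lam0, lam0 ^ 2, rfl, sq_nonneg _, le_rfl, zero_le_one, by ring, by simp⟩, ?_⟩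
    rw [klein_norm_eq_one_iff (sq_nonneg _)]

theorem exists_mem_ordinaryRange_iff {A : Matrix (Fin 2) (Fin 2) ℂ} {lam t : ℂ} {lam0 : ℝ}
    (him : lam.im ≠ 0)
    (e : OrthonormalBasis (Fin 2) ℂ (EuclideanSpace ℂ (Fin 2)))
    (h0 : Matrix.toEuclideanLin A (e 0) = (lam0 : ℂ) • e 0)
    (h1 : Matrix.toEuclideanLin A (e 1) = t • e 0 + lam • e 1) :
    ∃ h : ℝ, 0 < h ∧ h ≤ (toInfinity lam0 (hPoint lam him)).im ∧
      (t ≠ 0 → h < (toInfinity lam0 (hPoint lam him)).im) ∧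
      ∀ x : ℍ, x ∈ ordinaryRange A ↔
        h ^ 2 * ((toInfinity lam0 x).re - (toInfinity lam0 (hPoint lam him)).re) ^ 2 ≤
          ((toInfinity lam0 (hPoint lam him)).im ^ 2 - h ^ 2) *
            ((toInfinity lam0 x).im ^ 2 - h ^ 2) ∧ h ≤ (toInfinity lam0 x).im := by
  have hm : 0 < |lam.im| := abs_pos.2 him
  have hnL : Complex.normSq ((hPoint lam him : ℂ) - lam0) = Complex.normSq (lam - lam0) := by
    simp [hPoint, Complex.normSq_apply]
  have hLim : (toInfinity lam0 (hPoint lam him)).im =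
      |lam.im| / Complex.normSq (lam - lam0) := by
    rw [toInfinity_im, hnL]
    rfl
  have hLre : (toInfinity lam0 (hPoint lam him)).re =
      -(lam.re - lam0) / Complex.normSq (lam - lam0) := by
    rw [toInfinity_re, hnL]
    rfl
  have hn : Complex.normSq (lam - lam0) = (lam.re - lam0) ^ 2 + |lam.im| ^ 2 := by
    rw [Complex.normSq_apply, sq_abs]
    simp
    ring
  set n := Complex.normSq (lam - lam0) with hn_def
  set m := |lam.im| with hm_def
  have hn0 : 0 < n := by rw [hn]; positivity
  have hτ : 0 ≤ Complex.normSq t := Complex.normSq_nonneg t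
  set N := n + Complex.normSq t with hN
  have hN0 : 0 < N := by positivity
  have hh2 : (m / √(n * N)) ^ 2 = m ^ 2 / (n * N) := by
    rw [div_pow, Real.sq_sqrt (by positivity)]
  -- The image of `L` has height `m / n`. Replacing one factor `√n` by `√N`, where `N = n + |t|²`,
  -- lowers it, strictly if `t ≠ 0`.
  refine ⟨m / √(n * N), by positivity, ?_, ?_, ?_⟩
  · rw [hLim]
    gcongr
    apply Real.le_sqrt_of_sq_le
    nlinarith
  · intro ht
    have := Complex.normSq_pos.2 ht
    rw [hLim]
    gcongr
    apply Real.lt_sqrt_of_sq_lt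
    nlinarith
  · intro x
    rw [hLim, hLre, toInfinity_im, toInfinity_re]
    have hD : Complex.normSq ((x : ℂ) - lam0) = (x.re - lam0) ^ 2 + x.im ^ 2 := by
      rw [Complex.normSq_apply]
      simp
      ring
    have hD' : Complex.normSq (x : ℂ) - 2 * lam0 * (x : ℂ).re + lam0 ^ 2 =
        Complex.normSq ((x : ℂ) - lam0) := by
      rw [Complex.normSq_apply, Complex.normSq_apply]
      simp
      ring
    have hD0 := normSq_sub_pos lam0 x
    rw [← quadratic_iff x.im_pos hm hτ hD hn hN (by positivity) hh2]
    change iotaBCK x ∈ conformalRange A ↔ _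
    rw [mem_conformalRange_iff e h0 h1, klein_re_normSq]
    constructor
    · rintro ⟨P, a, b, hp, hb, hP0, hP1, hbP, haP⟩
      obtain ⟨rfl, rfl⟩ := klein_inj (Complex.normSq_nonneg _) hb hp
      have hP : P = Complex.normSq ((x : ℂ) - lam0) / N := by
        rw [eq_div_iff hN0.ne', ← hD', hbP]
      rw [← hP]
      refine ⟨?_, haP⟩
      rw [← hD', hbP]
      nlinarith
    · rintro ⟨hle, hq⟩
      refine ⟨Complex.normSq ((x : ℂ) - lam0) / N, _, _, rfl, Complex.normSq_nonneg _,
        by positivity, (div_le_one hN0).2 hle, ?_, hq⟩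
      rw [hD', div_mul_cancel₀ _ hN0.ne']

/-! ### Vertex, reflected point and the associated horocycle -/

/-- The point lying, after `ξ` has been moved to infinity, at height `h` on the vertical line
through the image of `L`. -/
def geodesicPoint (ξ : ℝ) (L : ℍ) (h : ℝ) (hh : 0 < h) : ℍ :=
  (toInfinity ξ).symm ⟨⟨(toInfinity ξ L).re, h⟩, hh⟩

theorem toInfinity_geodesicPoint_im (ξ : ℝ) (L : ℍ) {h : ℝ} (hh : 0 < h) :
    (toInfinity ξ (geodesicPoint ξ L h hh)).im = h := by
  simp [geodesicPoint]

theorem toInfinity_geodesicPoint_re (ξ : ℝ) (L : ℍ) {h : ℝ} (hh : 0 < h) :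
    (toInfinity ξ (geodesicPoint ξ L h hh)).re = (toInfinity ξ L).re := by
  simp [geodesicPoint]

theorem dist_eq_of_toInfinity_re_eq {ξ : ℝ} {x y : ℍ}
    (h : (toInfinity ξ x).re = (toInfinity ξ y).re) :
    dist x y = |log (toInfinity ξ x).im - log (toInfinity ξ y).im| := by
  rw [← (toInfinity ξ).dist_eq, UpperHalfPlane.dist_of_re_eq h, Real.dist_eq]

/-- If `h ≤ l` are the heights of `V` and `L` over the asymptotic point, then the points of height
`h ^ 2 / l` form the horocycle through the reflection of `L` in `V`. -/
theorem isHMidpoint_geodesicPoint {ξ : ℝ} {L : ℍ} {h : ℝ} (hh : 0 < h)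
    (hL : h ≤ (toInfinity ξ L).im) {k : ℝ} (hk : 0 < k)
    (hkL : k = h ^ 2 / (toInfinity ξ L).im) :
    IsHMidpoint (geodesicPoint ξ L h hh) L (geodesicPoint ξ L k hk) := by
  have hl := (toInfinity ξ L).im_pos
  have hlog : log k = 2 * log h - log (toInfinity ξ L).im := by
    rw [hkL, log_div (by positivity) hl.ne', log_pow]
    norm_num
  have hle : log h ≤ log (toInfinity ξ L).im := log_le_log hh hL
  have d1 : dist L (geodesicPoint ξ L h hh) = log (toInfinity ξ L).im - log h := by
    rw [dist_eq_of_toInfinity_re_eq (toInfinity_geodesicPoint_re ξ L hh).symm,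
      toInfinity_geodesicPoint_im, abs_of_nonneg (by linarith)]
  have d2 : dist (geodesicPoint ξ L h hh) (geodesicPoint ξ L k hk) =
      log (toInfinity ξ L).im - log h := by
    rw [dist_eq_of_toInfinity_re_eq (ξ := ξ)
      (by rw [toInfinity_geodesicPoint_re, toInfinity_geodesicPoint_re]),
      toInfinity_geodesicPoint_im, toInfinity_geodesicPoint_im, hlog,
      abs_of_nonneg (by linarith)]
    ring
  have d3 : dist L (geodesicPoint ξ L k hk) = 2 * (log (toInfinity ξ L).im - log h) := by
    rw [dist_eq_of_toInfinity_re_eq (toInfinity_geodesicPoint_re ξ L hk).symm,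
      toInfinity_geodesicPoint_im, hlog, abs_of_nonneg (by linarith)]
    ring
  exact ⟨by rw [d1, d2], by rw [d1, d2, d3]; ring⟩

/-- The vertex is the lowest point once `ξ` is at infinity: at height `h` the quadratic condition
forces the real part of `L`. The choice of `c` only shifts the distance function by a constant. -/
theorem isVertex_geodesicPoint {ξ : ℝ} {L : ℍ} {h : ℝ} (hh : 0 < h) {R : Set ℍ}
    (hR : ∀ x : ℍ, x ∈ R ↔ h ^ 2 * ((toInfinity ξ x).re - (toInfinity ξ L).re) ^ 2 ≤
      ((toInfinity ξ L).im ^ 2 - h ^ 2) * ((toInfinity ξ x).im ^ 2 - h ^ 2) ∧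
        h ≤ (toInfinity ξ x).im)
    {c : ℝ} (hc : 0 < c) : IsVertex (signedDist ξ c) R (geodesicPoint ξ L h hh) := by
  constructor
  · rw [hR, toInfinity_geodesicPoint_im, toInfinity_geodesicPoint_re]
    simp
  · intro x hx hne
    obtain ⟨h1, h2⟩ := (hR x).1 hx
    rw [signedDist_eq_neg_log hc, signedDist_eq_neg_log hc, toInfinity_geodesicPoint_im]
    apply neg_lt_neg
    have h3 : h < (toInfinity ξ x).im := by
      refine lt_of_le_of_ne h2 fun heq => hne ?_
      apply (toInfinity ξ).injective
      refine UpperHalfPlane.ext_re_im ?_ ?_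
      · rw [toInfinity_geodesicPoint_re]
        rw [← heq, sub_self, mul_zero] at h1
        have h4 : ((toInfinity ξ x).re - (toInfinity ξ L).re) ^ 2 ≤ 0 :=
          nonpos_of_mul_nonpos_right h1 (by positivity)
        exact sub_eq_zero.1 (pow_eq_zero_iff two_ne_zero |>.1 (le_antisymm h4 (sq_nonneg _)))
      · rw [toInfinity_geodesicPoint_im, heq]
    exact log_lt_log (by positivity) (by gcongr)

theorem IsVertex.unique {d : ℍ → ℝ} {R : Set ℍ} {V W : ℍ} (hV : IsVertex d R V)
    (hW : IsVertex d R W) : V = W := by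
  by_contra hne
  have h1 := hV.2 W hW.1 (Ne.symm hne)
  have h2 := hW.2 V hV.1 hne
  exact lt_asymm h1 h2

theorem horocycle_eq_setOf_signedDist {ξ c : ℝ} (hc : 0 < c) :
    horocycle ξ c = {x | signedDist ξ c x = 0} := by
  ext x
  have hpos : 0 < c * (toInfinity ξ x).im := mul_pos hc (toInfinity ξ x).im_pos
  rw [mem_horocycle_iff hc, Set.mem_ofPred, signedDist_eq_neg_log hc, neg_eq_zero,
    inv_eq_one_div, eq_div_iff hc.ne', mul_comm]
  exact ⟨fun h => by rw [h, log_one], fun h => eq_one_of_pos_of_log_eq_zero hpos h⟩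

theorem abs_signedDist {ξ c : ℝ} (hc : 0 < c) (x : ℍ) :
    |signedDist ξ c x| = Metric.infDist x (horocycle ξ c) := by
  rw [signedDist_eq_neg_log hc, abs_neg, infDist_horocycle hc]

/-- A point at most as far from `L` as from a horocycle enclosing `L` is inside the horocycle. -/
theorem abs_signedDist_eq_neg {ξ c : ℝ} (hc : 0 < c) {L : ℍ} (hL : signedDist ξ c L < 0) {x : ℍ}
    (hx : dist x L ≤ |signedDist ξ c x|) : |signedDist ξ c x| = -signedDist ξ c x := by
  refine abs_of_nonpos ?_
  by_contra hpos
  push Not at hpos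
  rw [abs_of_pos hpos] at hx
  -- The signed distance is 1-Lipschitz and negative at `L`, so a point outside the horocycle is
  -- farther from `L` than from the horocycle.
  have h1 := UpperHalfPlane.dist_log_im_le (toInfinity ξ x) (toInfinity ξ L)
  rw [(toInfinity ξ).dist_eq, Real.dist_eq, abs_sub_comm] at h1
  have h2 := le_abs_self (log (toInfinity ξ L).im - log (toInfinity ξ x).im)
  rw [signedDist_eq_neg_log hc, log_mul hc.ne' (toInfinity ξ _).im_pos.ne'] at hL hx
  linarith

theorem setOf_dist_add_signedDist_eq {ξ c : ℝ} (hc : 0 < c) {L : ℍ} (hL : signedDist ξ c L < 0) :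
    {x : ℍ | dist x L + signedDist ξ c x ≤ 0} = {x | dist x L ≤ |signedDist ξ c x|} ∧
    {x : ℍ | dist x L + signedDist ξ c x = 0} = {x | dist x L = |signedDist ξ c x|} := by
  constructor
  · ext x
    simp only [Set.mem_ofPred]
    constructor
    · intro h
      have := neg_le_abs (signedDist ξ c x)
      linarith
    · intro h
      rw [abs_signedDist_eq_neg hc hL h] at h
      linarith
  · ext x
    simp only [Set.mem_ofPred]
    constructor
    · intro h
      have : signedDist ξ c x ≤ 0 := by linarith [dist_nonneg (x := x) (y := L)]
      rw [abs_of_nonpos this]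
      linarith
    · intro h
      rw [abs_signedDist_eq_neg hc hL h.le] at h
      linarith

end ConformalRange

end

/-! ### Assembly of the theorem -/

theorem mainTheorem5 (A : Matrix (Fin 2) (Fin 2) ℂ) (lam : ℂ) (lam0 : ℝ)
    (hlam : Module.End.HasEigenvalue (Matrix.toLin' A) lam) (him : lam.im ≠ 0)
    (hlam0 : Module.End.HasEigenvalue (Matrix.toLin' A) (lam0 : ℂ))
    (d₀ : ℍ → ℝ) (hd₀ : ConformalRange.IsDistanceFunctionFrom lam0 d₀) :
    ConformalRange.asymptoticRange A = {ConformalRange.iotaBCK (lam0 : ℂ)} ∧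
    (∃! V : ℍ, ConformalRange.IsVertex d₀ (ConformalRange.ordinaryRange A) V) ∧
    ∀ V : ℍ, ConformalRange.IsVertex d₀ (ConformalRange.ordinaryRange A) V →
      ∀ (L : ℍ) (dC : ℍ → ℝ), L = ConformalRange.hPoint lam him →
        dC = (fun x => d₀ x + d₀ L - 2 * d₀ V) →
      ∃ c : ℝ, 0 < c ∧
        ConformalRange.horocycle lam0 c = {x | dC x = 0} ∧
        (∃ P : ℍ, ConformalRange.IsHMidpoint V L P ∧ P ∈ ConformalRange.horocycle lam0 c) ∧
        (∀ x : ℍ, dC x = ConformalRange.signedDist lam0 c x) ∧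
        ConformalRange.ordinaryRange A = {x | dist x L + dC x ≤ 0} ∧
        frontier (ConformalRange.ordinaryRange A) = {x | dist x L + dC x = 0} ∧
        (¬ IsStarNormal A →
          ConformalRange.ordinaryRange A = {x | dist x L ≤ |dC x|} ∧
          frontier (ConformalRange.ordinaryRange A) = {x | dist x L = |dC x|} ∧
          frontier (ConformalRange.ordinaryRange A) =
            {x | dist x L = Metric.infDist x (ConformalRange.horocycle lam0 c)} ∧
          ConformalRange.IsSyntheticEllipticParabola lam0 c L V
            (frontier (ConformalRange.ordinaryRange A))) := by
  have hne : lam ≠ (lam0 : ℂ) := fun h => him (by rw [h, Complex.ofReal_im])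
  obtain ⟨e, t, he0, he1⟩ := ConformalRange.exists_triangularizing_basis hne hlam hlam0
  obtain ⟨h, hh, hhL, hlt, hR⟩ := ConformalRange.exists_mem_ordinaryRange_iff him e he0 he1
  obtain ⟨c₀, hc₀, rfl⟩ := hd₀
  have hvertex := ConformalRange.isVertex_geodesicPoint hh hR hc₀
  refine ⟨ConformalRange.asymptoticRange_eq him e he0 he1,
    ⟨_, hvertex, fun W hW => hW.unique hvertex⟩, ?_⟩
  intro V hV L dC hL hdC
  rw [← hL] at hhL hlt hR hvertex
  obtain rfl := hV.unique hvertex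
  have hl := (ConformalRange.toInfinity lam0 L).im_pos
  set l := (ConformalRange.toInfinity lam0 L).im with hl_def
  -- The parameter of a horocycle is the inverse of its height at infinity, here `h ^ 2 / l`, the
  -- reflection of height `l` in height `h`.
  have hc : 0 < l / h ^ 2 := by positivity
  have hk : 0 < h ^ 2 / l := by positivity
  -- The normalization `c₀` cancels, since the coefficients `1, 1, -2` in `dC` sum to zero.
  have hdC' : dC = ConformalRange.signedDist lam0 (l / h ^ 2) := by
    rw [hdC]
    ext x
    have hx := (ConformalRange.toInfinity lam0 x).im_pos
    simp only [ConformalRange.signedDist_eq_neg_log hc₀, ConformalRange.signedDist_eq_neg_log hc,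
      ConformalRange.toInfinity_geodesicPoint_im]
    rw [Real.log_mul hc₀.ne' hx.ne', Real.log_mul hc₀.ne' hl.ne', Real.log_mul hc₀.ne' hh.ne',
      Real.log_mul hc.ne' hx.ne', Real.log_div hl.ne' (by positivity), Real.log_pow]
    push_cast
    ring
  have hP : ConformalRange.geodesicPoint lam0 L (h ^ 2 / l) hk ∈
      ConformalRange.horocycle lam0 (l / h ^ 2) := by
    rw [ConformalRange.mem_horocycle_iff hc, ConformalRange.toInfinity_geodesicPoint_im, inv_div]
  have hmid := ConformalRange.isHMidpoint_geodesicPoint hh hhL hk rfl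
  have hRange : ConformalRange.ordinaryRange A =
      {x | dist x L + ConformalRange.signedDist lam0 (l / h ^ 2) x ≤ 0} := by
    ext x
    rw [hR, ← ConformalRange.dist_le_log_iff hh hhL, (ConformalRange.toInfinity lam0).dist_eq,
      Set.mem_ofPred, ConformalRange.signedDist_eq_neg_log hc, ← sub_eq_add_neg, sub_nonpos]
  have hfrontier : frontier (ConformalRange.ordinaryRange A) =
      {x | dist x L + ConformalRange.signedDist lam0 (l / h ^ 2) x = 0} := by
    rw [hRange, ConformalRange.frontier_dist_add_signedDist hc]
  subst hdC'
  refine ⟨l / h ^ 2, hc, ConformalRange.horocycle_eq_setOf_signedDist hc, ⟨_, hmid, hP⟩,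
    fun _ => rfl, hRange, hfrontier, fun hA => ?_⟩
  have ht : t ≠ 0 := by
    rintro rfl
    exact hA (ConformalRange.isStarNormal_of_diagonal e he0 (by rw [he1, zero_smul, zero_add]))
  have hhl := hlt ht
  have hlog : 0 < Real.log (l / h ^ 2 * l) := by
    apply Real.log_pos
    rw [div_mul_eq_mul_div, one_lt_div (by positivity)]
    nlinarith
  have hneg : ConformalRange.signedDist lam0 (l / h ^ 2) L < 0 := by
    rw [ConformalRange.signedDist_eq_neg_log hc]
    exact neg_neg_of_pos hlog
  obtain ⟨hle, heq⟩ := ConformalRange.setOf_dist_add_signedDist_eq hc hneg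
  refine ⟨by rw [hRange, hle], by rw [hfrontier, heq], ?_, hc, hneg, ?_, _, ⟨hP, ?_⟩, hmid⟩
  · rw [hfrontier, heq]
    simp only [ConformalRange.abs_signedDist hc]
  · rw [hfrontier]
    simp only [dist_comm]
  -- The reflected point lies vertically below `L`, so its distance from `L` is the difference of
  -- log-heights, which is also the distance from `L` to the horocycle.
  · rw [ConformalRange.infDist_horocycle hc, abs_of_pos hlog,
      ConformalRange.dist_eq_of_toInfinity_re_eq
        (ConformalRange.toInfinity_geodesicPoint_re lam0 L hk).symm,
      ConformalRange.toInfinity_geodesicPoint_im, ← Real.log_div hl.ne' hk.ne',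
      show l / (h ^ 2 / l) = l / h ^ 2 * l by field_simp, abs_of_pos hlog]
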